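/- For a finite graph $H$, let $\nu(H)$ be the maximum size of a set of pairwise edge-disjoint triangles of $H$, and let $\tau(H)$ be the minimum size of a set $F$ of edges of $H$ such that every triangle of $H$ contains a member of $F$. Let $G_{n,p}$ be the binomial random graph on $n$ labelled vertices, in which each of the $\binom n2$ possible edges is present independently with probability $p$. Theorem. Let $p=p(n)\in[0,1]$ be such that $d=(n-2)p^2\le 1/2$ for all sufficiently large $n$. Then with high probability $\tau(G_{n,p})\sim\nu(G_{n,p})$; that is, for every $\varepsilon>0$, $$\Pr\bigl(|\tau(G_{n,p})-\nu(G_{n,p})|\le\varepsilon\,\nu(G_{n,p})\bigr)\to 1\qquad (n\to\infty).$$ -/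

import Mathlib

open Filter Topology

namespace TriangleTuza

variable {V : Type*}

/-- The edges (unordered pairs of distinct vertices) spanned by a set `t` of vertices; when `t` is
the vertex set of a triangle, these are the three edges of the triangle. -/
def spannedEdges (t : Finset V) : Set (Sym2 V) :=
  {e | ¬ e.IsDiag ∧ ∀ v ∈ e, v ∈ t}

/-- `T` is a set of pairwise edge-disjoint triangles of `H` (a triangle is given by its vertex set,
a clique on three vertices). -/
def IsTriangleMatching (H : SimpleGraph V) (T : Finset (Finset V)) : Prop :=
  (∀ t ∈ T, H.IsNClique 3 t) ∧
    ∀ s ∈ T, ∀ t ∈ T, s ≠ t → Disjoint (spannedEdges s) (spannedEdges t)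

/-- `F` is a set of edges of `H` such that each triangle of `H` contains a member of `F`. -/
def IsTriangleCover (H : SimpleGraph V) (F : Finset (Sym2 V)) : Prop :=
  (∀ e ∈ F, e ∈ H.edgeSet) ∧
    ∀ t : Finset V, H.IsNClique 3 t → ∃ e ∈ F, e ∈ spannedEdges t

/-- `ν(H)`: the maximum size of a set of edge-disjoint triangles of the finite graph `H`. -/
noncomputable def nu [Fintype V] (H : SimpleGraph V) : ℕ :=
  sSup {k | ∃ T : Finset (Finset V), IsTriangleMatching H T ∧ T.card = k}

/-- `τ(H)`: the minimum size of a set of edges of the finite graph `H` meeting every triangle. -/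
noncomputable def tau [Fintype V] (H : SimpleGraph V) : ℕ :=
  sInf {k | ∃ F : Finset (Sym2 V), IsTriangleCover H F ∧ F.card = k}

/-- The maximum defining `ν(H)` is attained. -/
theorem nu_isGreatest [Fintype V] (H : SimpleGraph V) :
    IsGreatest {k | ∃ T : Finset (Finset V), IsTriangleMatching H T ∧ T.card = k} (nu H) := by
  have hb : BddAbove {k | ∃ T : Finset (Finset V), IsTriangleMatching H T ∧ T.card = k} := by
    refine ⟨Fintype.card (Finset V), ?_⟩
    rintro k ⟨T, -, rfl⟩
    exact Finset.card_le_univ T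
  have hne : {k | ∃ T : Finset (Finset V), IsTriangleMatching H T ∧ T.card = k}.Nonempty :=
    ⟨0, ∅, by simp [IsTriangleMatching]⟩
  exact ⟨Nat.sSup_mem hne hb, fun k hk => le_csSup hb hk⟩

/-- The minimum defining `τ(H)` is attained. -/
theorem tau_isLeast [Fintype V] (H : SimpleGraph V) :
    IsLeast {k | ∃ F : Finset (Sym2 V), IsTriangleCover H F ∧ F.card = k} (tau H) := by
  classical
  have hne : {k | ∃ F : Finset (Sym2 V), IsTriangleCover H F ∧ F.card = k}.Nonempty := by
    refine ⟨_, H.edgeFinset, ⟨fun e he => by simpa using he, fun t ht => ?_⟩, rfl⟩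
    obtain ⟨a, b, c, hab, hac, hbc, rfl⟩ := SimpleGraph.is3Clique_iff.1 ht
    exact ⟨s(a, b), by simpa using hab, by simpa using hab.ne, by simp⟩
  exact ⟨Nat.sInf_mem hne, fun k hk => Nat.sInf_le hk⟩

end TriangleTuza

/-! Write `μ` for the expected number of triangles, `C(n,3) p^3`. Always `ν ≤ τ`, so it suffices
that `E(τ - ν)` is `o(μ)` and that `ν` is rarely much smaller than `μ`.

For the first point, call a triangle a leaf of a family if at most one of its edges lies in other
members. A family all of whose nonempty subfamilies have a leaf satisfies `τ = ν`, by greedy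
peeling. A family without leaves lets a stacked walk continue from any triangle; by finiteness the
walk must eventually return to an old vertex, through a "closing" triangle. Hence `τ - ν` is at most
the number of closing triangles (`tau_le_nu_add_card_closingTriangles`). A closed walk has one edge
more than its walk and no new vertex, which costs a factor `p`, and the sum over lengths is
geometric with ratio `2d`.

At `d = 1/2` this series is not summable uniformly, so the edge probability is first lowered to `(1
- δ)p`. Passing back to `p` costs at most `3δμ` in expectation, since each new triangle raises `τ`
by at most one and `ν` only grows (`bernoulliExp_tau_sub_nu_le`). Since `p → 0`, the total is
`o(μ)`.

For the second point, thin to `θp`: few triangles then share edges, and a second moment bound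
applies (`bernoulliExp_nu_lt_le_of_thinning`). Markov's inequality finishes when `μ` is large; when
`μ` is bounded, integrality of `τ - ν` suffices. -/

namespace TriangleTuza

/-! ### Expectations over random subsets with independent inclusions -/

section BernoulliExpectation

variable {ι : Type*} [DecidableEq ι]

/-- The expectation of `f` at the random subset of `D` that contains each element of `D`
independently with probability `p`. -/
noncomputable def bernoulliExp (p : ℝ) (D : Finset ι) (f : Finset ι → ℝ) : ℝ :=
  ∑ s ∈ D.powerset, p ^ s.card * (1 - p) ^ (D \ s).card * f s

theorem bernoulliExp_empty (p : ℝ) (f : Finset ι → ℝ) : bernoulliExp p ∅ f = f ∅ := by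
  simp [bernoulliExp]

theorem bernoulliExp_insert (p : ℝ) {D : Finset ι} {a : ι} (ha : a ∉ D) (f : Finset ι → ℝ) :
    bernoulliExp p (insert a D) f =
      p * bernoulliExp p D (fun s => f (insert a s)) + (1 - p) * bernoulliExp p D f := by
  unfold bernoulliExp
  rw [Finset.sum_powerset_insert ha, add_comm, Finset.mul_sum, Finset.mul_sum]
  congr 1
  · refine Finset.sum_congr rfl fun s hs => ?_
    have has : a ∉ s := fun h => ha (Finset.mem_powerset.1 hs h)
    rw [Finset.card_insert_of_notMem has, Finset.insert_sdiff_insert, Finset.sdiff_insert,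
      Finset.erase_eq_of_notMem (by simp [ha])]
    ring
  · refine Finset.sum_congr rfl fun s hs => ?_
    have has : a ∉ s := fun h => ha (Finset.mem_powerset.1 hs h)
    rw [Finset.insert_sdiff_of_notMem _ has, Finset.card_insert_of_notMem (by simp [ha])]
    ring

theorem bernoulliExp_const (p : ℝ) (D : Finset ι) (c : ℝ) :
    bernoulliExp p D (fun _ => c) = c := by
  induction D using Finset.induction_on with
  | empty => exact bernoulliExp_empty _ _
  | insert a D ha ih => rw [bernoulliExp_insert p ha, ih]; ring

theorem bernoulliExp_add (p : ℝ) (D : Finset ι) (f g : Finset ι → ℝ) :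
    bernoulliExp p D (fun s => f s + g s) = bernoulliExp p D f + bernoulliExp p D g := by
  simp only [bernoulliExp, mul_add, Finset.sum_add_distrib]

theorem bernoulliExp_sub (p : ℝ) (D : Finset ι) (f g : Finset ι → ℝ) :
    bernoulliExp p D (fun s => f s - g s) = bernoulliExp p D f - bernoulliExp p D g := by
  simp only [bernoulliExp, mul_sub, Finset.sum_sub_distrib]

theorem bernoulliExp_const_mul (p : ℝ) (D : Finset ι) (c : ℝ) (f : Finset ι → ℝ) :
    bernoulliExp p D (fun s => c * f s) = c * bernoulliExp p D f := by
  simp only [bernoulliExp, Finset.mul_sum]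
  exact Finset.sum_congr rfl fun s _ => by ring

theorem bernoulliExp_sum {κ : Type*} (p : ℝ) (D : Finset ι) (K : Finset κ)
    (f : κ → Finset ι → ℝ) :
    bernoulliExp p D (fun s => ∑ k ∈ K, f k s) = ∑ k ∈ K, bernoulliExp p D (f k) := by
  simp only [bernoulliExp, Finset.mul_sum]
  exact Finset.sum_comm

theorem bernoulliExp_congr (p : ℝ) {D : Finset ι} {f g : Finset ι → ℝ}
    (h : ∀ s ⊆ D, f s = g s) : bernoulliExp p D f = bernoulliExp p D g :=
  Finset.sum_congr rfl fun s hs => by rw [h s (Finset.mem_powerset.1 hs)]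

theorem bernoulliExp_le {p : ℝ} (hp₀ : 0 ≤ p) (hp₁ : p ≤ 1) {D : Finset ι}
    {f g : Finset ι → ℝ} (h : ∀ s ⊆ D, f s ≤ g s) :
    bernoulliExp p D f ≤ bernoulliExp p D g := by
  have : 0 ≤ 1 - p := by linarith
  exact Finset.sum_le_sum fun s hs =>
    mul_le_mul_of_nonneg_left (h s (Finset.mem_powerset.1 hs)) (by positivity)

/-- The expectation of a monotone function is monotone in the inclusion probability. -/
theorem bernoulliExp_mono {p q : ℝ} (hp₀ : 0 ≤ p) (hpq : p ≤ q) (hq₁ : q ≤ 1) {D : Finset ι}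
    {f : Finset ι → ℝ} (hf : ∀ s t, s ⊆ t → t ⊆ D → f s ≤ f t) :
    bernoulliExp p D f ≤ bernoulliExp q D f := by
  induction D using Finset.induction_on generalizing f with
  | empty => simp [bernoulliExp_empty]
  | insert a D ha ih =>
    rw [bernoulliExp_insert p ha, bernoulliExp_insert q ha]
    have h₁ := ih (f := fun s => f (insert a s)) fun s t hst htD =>
      hf _ _ (Finset.insert_subset_insert a hst) (Finset.insert_subset_insert a htD)
    have h₂ := ih (f := f) fun s t hst htD => hf s t hst (htD.trans (Finset.subset_insert a D))
    have h₃ : bernoulliExp q D f ≤ bernoulliExp q D (fun s => f (insert a s)) :=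
      bernoulliExp_le (hp₀.trans hpq) hq₁ fun s hs =>
        hf s _ (Finset.subset_insert a s) (Finset.insert_subset_insert a hs)
    -- Conditioning on `a`: moving weight `q - p` from the sets without `a` to those with `a` gains
    -- by `h₃`.
    nlinarith [mul_le_mul_of_nonneg_left h₁ hp₀,
      mul_le_mul_of_nonneg_left h₂ (show 0 ≤ 1 - p by linarith),
      mul_nonneg (sub_nonneg.2 hpq) (sub_nonneg.2 h₃)]

theorem bernoulliExp_subset (p : ℝ) {D A : Finset ι} (hA : A ⊆ D) :
    bernoulliExp p D (fun s => if A ⊆ s then 1 else 0) = p ^ A.card := by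
  induction D using Finset.induction_on generalizing A with
  | empty => obtain rfl := Finset.subset_empty.1 hA; simp [bernoulliExp_empty]
  | insert a D ha ih =>
    rw [bernoulliExp_insert p ha]
    by_cases haA : a ∈ A
    · have h₁ : bernoulliExp p D (fun s => if A ⊆ s then 1 else 0) = 0 := by
        rw [bernoulliExp_congr p (g := fun _ => 0), bernoulliExp_const]
        exact fun s hs => if_neg fun h => ha (hs (h haA))
      have h₂ : ∀ s, A ⊆ insert a s ↔ A.erase a ⊆ s := fun s => Finset.subset_insert_iff
      simp only [h₂, h₁, ih (A := A.erase a) (Finset.subset_insert_iff.1 hA)]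
      rw [← Finset.card_erase_add_one haA]
      ring
    · have h₂ : ∀ s, A ⊆ insert a s ↔ A ⊆ s := fun s =>
        Finset.subset_insert_iff_of_notMem haA
      simp only [h₂, ih ((Finset.subset_insert_iff_of_notMem haA).1 hA)]
      ring

end BernoulliExpectation

/-! ### The random graph as a random set of pairs -/

section RandomGraph

variable (V : Type*) [Fintype V] [DecidableEq V]

/-- The set of unordered pairs of distinct vertices. -/
def pairs : Finset (Sym2 V) := {e | ¬ e.IsDiag}

-- Graphs correspond bijectively to subsets of `pairs V`, with matching weights. Probabilities thus
-- become finite sums, open to induction on the set of pairs.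
open Classical in
theorem binomialRandom_real (p : unitInterval) (S : Set (SimpleGraph V)) :
    (SimpleGraph.binomialRandom V p).real S =
      bernoulliExp (p : ℝ) (pairs V)
        (fun s => if SimpleGraph.fromEdgeSet (s : Set (Sym2 V)) ∈ S then 1 else 0) := by
  have hinj : Set.InjOn (fun s : Finset (Sym2 V) => SimpleGraph.fromEdgeSet (s : Set (Sym2 V)))
      (pairs V).powerset := by
    intro s hs t ht hst
    have key : ∀ s ∈ (pairs V).powerset,
        (SimpleGraph.fromEdgeSet (s : Set (Sym2 V))).edgeSet = s := by
      intro s hs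
      rw [SimpleGraph.edgeSet_fromEdgeSet]
      ext e
      simp only [Set.mem_sdiff, Finset.mem_coe, Sym2.mem_diagSet]
      exact ⟨fun h => h.1, fun h => ⟨h, by simpa [pairs] using Finset.mem_powerset.1 hs h⟩⟩
    have := congrArg SimpleGraph.edgeSet hst
    simp only at this
    rw [key s hs, key t ht] at this
    exact_mod_cast this
  have himg : (Finset.univ : Finset (SimpleGraph V)) = (pairs V).powerset.image
      (fun s : Finset (Sym2 V) => SimpleGraph.fromEdgeSet (s : Set (Sym2 V))) := by
    symm
    rw [Finset.eq_univ_iff_forall]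
    intro G
    refine Finset.mem_image.2 ⟨G.edgeFinset, ?_, by simp⟩
    rw [Finset.mem_powerset]
    intro e he
    simpa [pairs] using G.not_isDiag_of_mem_edgeFinset he
  have hkey : ∀ s ∈ (pairs V).powerset,
      (SimpleGraph.fromEdgeSet (s : Set (Sym2 V))).edgeSet.ncard = s.card := by
    intro s hs
    rw [SimpleGraph.edgeSet_fromEdgeSet, ← Set.ncard_coe_finset]
    congr 1
    ext e
    simp only [Set.mem_sdiff, Finset.mem_coe, Sym2.mem_diagSet]
    exact ⟨fun h => h.1, fun h => ⟨h, by simpa [pairs] using Finset.mem_powerset.1 hs h⟩⟩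
  have hcard : (pairs V).card = (Nat.card V).choose 2 := by
    rw [Nat.card_eq_fintype_card, ← Sym2.card_diagSet_compl, ← Set.toFinset_card]
    congr 1
    ext e
    simp [pairs]
  have hS : S = ((Finset.univ.filter (· ∈ S) : Finset (SimpleGraph V)) : Set (SimpleGraph V)) := by
    simp
  have : MeasurableSingletonClass (SimpleGraph V) := ⟨fun G => by
    rw [← SimpleGraph.measurableEmbedding_edgeSet.measurableSet_image, Set.image_singleton]
    exact measurableSet_singleton _⟩
  conv_lhs => rw [hS]
  rw [← MeasureTheory.sum_measureReal_singleton, Finset.sum_filter, himg,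
    Finset.sum_image hinj, bernoulliExp]
  refine Finset.sum_congr rfl fun s hs => ?_
  rw [MeasureTheory.measureReal_def, SimpleGraph.binomialRandom_singleton, hkey s hs,
    Finset.card_sdiff_of_subset (Finset.mem_powerset.1 hs), hcard]
  simp

end RandomGraph

/-! ### Deterministic relations between covers and matchings -/

section Triangles

variable {V : Type*} [Fintype V] [DecidableEq V]

/-- The pairs of distinct vertices of `t`, as a finite set. -/
def innerPairs (t : Finset V) : Finset (Sym2 V) := {e ∈ pairs V | ∀ v ∈ e, v ∈ t}

theorem mem_innerPairs {t : Finset V} {e : Sym2 V} : e ∈ innerPairs t ↔ e ∈ spannedEdges t := by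
  simp [innerPairs, pairs, spannedEdges]

omit [Fintype V] [DecidableEq V] in
theorem mk_mem_spannedEdges {t : Finset V} {a b : V} :
    s(a, b) ∈ spannedEdges t ↔ a ≠ b ∧ a ∈ t ∧ b ∈ t := by
  simp [spannedEdges]

theorem card_innerPairs (t : Finset V) : (innerPairs t).card = t.card.choose 2 := by
  rw [← Sym2.card_image_offDiag]
  congr 1
  ext e
  induction e with
  | _ a b =>
    simp only [mem_innerPairs, mk_mem_spannedEdges, Finset.mem_image, Finset.mem_offDiag,
      Prod.exists]
    constructor
    · rintro ⟨h, ha, hb⟩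
      exact ⟨a, b, ⟨ha, hb, h⟩, rfl⟩
    · rintro ⟨x, y, ⟨hx, hy, hxy⟩, h⟩
      rcases Sym2.eq_iff.1 h with ⟨rfl, rfl⟩ | ⟨rfl, rfl⟩
      · exact ⟨hxy, hx, hy⟩
      · exact ⟨hxy.symm, hy, hx⟩

/-- The triangles of the graph with edge set `s`. -/
def triangles (s : Finset (Sym2 V)) : Finset (Finset V) :=
  {t ∈ Finset.univ.powersetCard 3 | innerPairs t ⊆ s}

theorem mem_triangles {s : Finset (Sym2 V)} {t : Finset V} :
    t ∈ triangles s ↔ t.card = 3 ∧ innerPairs t ⊆ s := by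
  simp [triangles, Finset.mem_powersetCard]

theorem triangles_mono {s s' : Finset (Sym2 V)} (h : s ⊆ s') : triangles s ⊆ triangles s' :=
  fun _ ht => mem_triangles.2 ⟨(mem_triangles.1 ht).1, (mem_triangles.1 ht).2.trans h⟩

/-- The graph with edge set `s`. -/
abbrev graphOf (s : Finset (Sym2 V)) : SimpleGraph V :=
  SimpleGraph.fromEdgeSet (s : Set (Sym2 V))

theorem isNClique_iff {s : Finset (Sym2 V)} {t : Finset V} :
    (graphOf s).IsNClique 3 t ↔ t ∈ triangles s := by
  rw [mem_triangles, SimpleGraph.isNClique_iff, and_comm, SimpleGraph.isClique_iff]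
  refine and_congr_right fun _ => ⟨fun h e he => ?_, fun h a ha b hb hab => ?_⟩
  · induction e with
    | _ a b =>
      rw [mem_innerPairs, mk_mem_spannedEdges] at he
      have := h he.2.1 he.2.2 he.1
      simpa using ((SimpleGraph.fromEdgeSet_adj _).1 this).1
  · refine (SimpleGraph.fromEdgeSet_adj _).2 ⟨?_, hab⟩
    exact h (mem_innerPairs.2 (mk_mem_spannedEdges.2 ⟨hab, ha, hb⟩))

omit [Fintype V] in
theorem exists_mem_spannedEdges {t : Finset V} (ht : t.card = 3) : ∃ e, e ∈ spannedEdges t := by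
  obtain ⟨a, b, c, hab, -, -, rfl⟩ := Finset.card_eq_three.1 ht
  exact ⟨s(a, b), mk_mem_spannedEdges.2 ⟨hab, by simp, by simp⟩⟩

theorem card_le_nu {s : Finset (Sym2 V)} {T : Finset (Finset V)} (hT : T ⊆ triangles s)
    (hd : ∀ t ∈ T, ∀ t' ∈ T, t ≠ t' → Disjoint (spannedEdges t) (spannedEdges t')) :
    T.card ≤ nu (graphOf s) :=
  (nu_isGreatest (graphOf s)).2 ⟨T, ⟨fun _ ht => isNClique_iff.2 (hT ht), hd⟩, rfl⟩

theorem exists_nu (s : Finset (Sym2 V)) : ∃ T ⊆ triangles s,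
    (∀ t ∈ T, ∀ t' ∈ T, t ≠ t' → Disjoint (spannedEdges t) (spannedEdges t')) ∧
      T.card = nu (graphOf s) := by
  obtain ⟨T, ⟨h₁, h₂⟩, h₃⟩ := (nu_isGreatest (graphOf s)).1
  exact ⟨T, fun t ht => isNClique_iff.1 (h₁ t ht), h₂, h₃⟩

theorem tau_le_card {s : Finset (Sym2 V)} (hs : s ⊆ pairs V) {F : Finset (Sym2 V)} (hF : F ⊆ s)
    (hc : ∀ t ∈ triangles s, ∃ e ∈ F, e ∈ spannedEdges t) : tau (graphOf s) ≤ F.card := by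
  refine (tau_isLeast (graphOf s)).2 ⟨F, ⟨fun e he => ?_, fun t ht =>
    hc t (isNClique_iff.1 ht)⟩, rfl⟩
  rw [SimpleGraph.edgeSet_fromEdgeSet]
  exact ⟨hF he, by simpa [pairs] using hs (hF he)⟩

theorem exists_tau (s : Finset (Sym2 V)) : ∃ F ⊆ s,
    (∀ t ∈ triangles s, ∃ e ∈ F, e ∈ spannedEdges t) ∧ F.card = tau (graphOf s) := by
  obtain ⟨F, ⟨h₁, h₂⟩, h₃⟩ := (tau_isLeast (graphOf s)).1
  refine ⟨F, fun e he => ?_, fun t ht => h₂ t (isNClique_iff.2 ht), h₃⟩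
  have := h₁ e he
  rw [SimpleGraph.edgeSet_fromEdgeSet] at this
  exact this.1

theorem nu_mono {s s' : Finset (Sym2 V)} (h : s ⊆ s') :
    nu (graphOf s) ≤ nu (graphOf s') := by
  obtain ⟨T, hT, hd, hc⟩ := exists_nu s
  exact hc ▸ card_le_nu (hT.trans (triangles_mono h)) hd

/-- A cover needs a separate edge for each of the edge-disjoint triangles. -/
theorem nu_le_tau [Nonempty V] (s : Finset (Sym2 V)) : nu (graphOf s) ≤ tau (graphOf s) := by
  obtain ⟨T, hT, hd, hc⟩ := exists_nu s
  obtain ⟨F, hF, hcov, hc'⟩ := exists_tau s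
  rw [← hc, ← hc']
  have : Nonempty (Sym2 V) := ⟨s(Classical.arbitrary V, Classical.arbitrary V)⟩
  choose! f hf using hcov
  refine Finset.card_le_card_of_injOn f (fun t ht => (hf t (hT ht)).1) fun t ht t' ht' h => ?_
  by_contra hne
  refine Set.disjoint_left.1 (hd t ht t' ht' hne) (hf t (hT ht)).2 ?_
  rw [h]
  exact (hf t' (hT ht')).2

/-- Adding edges increases the covering number by at most the number of new triangles. -/
theorem tau_add_card_triangles_le [Nonempty V] {s s' : Finset (Sym2 V)} (h : s ⊆ s') (hs' : s' ⊆ pairs V) :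
    tau (graphOf s') + (triangles s).card ≤ tau (graphOf s) + (triangles s').card := by
  obtain ⟨F, hF, hcov, hc⟩ := exists_tau s
  have hex : ∀ t ∈ triangles s', ∃ e, e ∈ spannedEdges t := fun t ht =>
    exists_mem_spannedEdges (mem_triangles.1 ht).1
  have : Nonempty (Sym2 V) := ⟨s(Classical.arbitrary V, Classical.arbitrary V)⟩
  choose! f hf using hex
  -- An old cover is repaired by one edge from each new triangle.
  have hle : tau (graphOf s') ≤ (F ∪ (triangles s' \ triangles s).image f).card := by
    refine tau_le_card hs' (Finset.union_subset (hF.trans h) ?_) fun t ht => ?_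
    · intro e he
      obtain ⟨t, ht, rfl⟩ := Finset.mem_image.1 he
      have ht := (Finset.mem_sdiff.1 ht).1
      exact (mem_triangles.1 ht).2 (mem_innerPairs.2 (hf t ht))
    · by_cases hts : t ∈ triangles s
      · obtain ⟨e, he, het⟩ := hcov t hts
        exact ⟨e, Finset.mem_union_left _ he, het⟩
      · exact ⟨f t, Finset.mem_union_right _
          (Finset.mem_image_of_mem f (Finset.mem_sdiff.2 ⟨ht, hts⟩)), hf t ht⟩
  have h₁ := Finset.card_union_le F ((triangles s' \ triangles s).image f)
  have h₂ : ((triangles s' \ triangles s).image f).card ≤ _ := Finset.card_image_le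
  have h₃ := Finset.card_sdiff_add_card_eq_card (triangles_mono h)
  omega

/-- A family of triangles in which every nonempty subfamily has a member sharing at most one of
its edges with other members has a cover and a matching of the same size. -/
theorem exists_cover_le_matching (S : Finset (Finset V)) (h3 : ∀ t ∈ S, t.card = 3)
    (hleaf : ∀ S' ⊆ S, S'.Nonempty → ∃ t ∈ S', ∃ e ∈ spannedEdges t,
      ∀ t' ∈ S', t' ≠ t → ∀ f ∈ spannedEdges t, f ∈ spannedEdges t' → f = e) :
    ∃ F : Finset (Sym2 V), ∃ T ⊆ S, (∀ e ∈ F, ∃ t ∈ S, e ∈ spannedEdges t) ∧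
      (∀ t ∈ S, ∃ e ∈ F, e ∈ spannedEdges t) ∧
      (∀ t ∈ T, ∀ t' ∈ T, t ≠ t' → Disjoint (spannedEdges t) (spannedEdges t')) ∧
      F.card ≤ T.card := by
  induction S using Finset.strongInduction with
  | H S ih =>
    obtain rfl | hS := S.eq_empty_or_nonempty
    · exact ⟨∅, ∅, by simp⟩
    obtain ⟨t, ht, e, he, hte⟩ := hleaf S subset_rfl hS
    -- Peel the leaf `t`: put `e` in the cover and `t` in the matching, and discard all triangles
    -- through `e`. The survivors are edge-disjoint from `t`, as `t` shares no other edge.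
    set S' := S.filter fun u => e ∉ innerPairs u with hS'
    have hsub : S' ⊆ S := Finset.filter_subset _ _
    have hmem : ∀ u, u ∈ S' ↔ u ∈ S ∧ e ∉ spannedEdges u := fun u => by
      rw [hS', Finset.mem_filter, mem_innerPairs]
    have htS' : t ∉ S' := fun h => ((hmem t).1 h).2 he
    obtain ⟨F, T, hT, hFS, hcov, hd, hc⟩ := ih S'
      (Finset.ssubset_iff_subset_ne.2 ⟨hsub, fun h => htS' (h ▸ ht)⟩)
      (fun u hu => h3 u (hsub hu)) fun R hR => hleaf R (hR.trans hsub)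
    have hdt : ∀ u ∈ T, Disjoint (spannedEdges t) (spannedEdges u) := fun u hu => by
      have hu' := (hmem u).1 (hT hu)
      refine Set.disjoint_left.2 fun f hft hfu => ?_
      have hfe := hte u hu'.1 (fun h => htS' (h ▸ hT hu)) f hft hfu
      exact hu'.2 (hfe ▸ hfu)
    refine ⟨insert e F, insert t T, Finset.insert_subset ht (hT.trans hsub), ?_, ?_, ?_, ?_⟩
    · intro f hf
      rcases Finset.mem_insert.1 hf with rfl | hf
      · exact ⟨t, ht, he⟩
      · obtain ⟨u, hu, hfu⟩ := hFS f hf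
        exact ⟨u, hsub hu, hfu⟩
    · intro u hu
      by_cases heu : e ∈ spannedEdges u
      · exact ⟨e, Finset.mem_insert_self _ _, heu⟩
      · obtain ⟨f, hf, hfu⟩ := hcov u ((hmem u).2 ⟨hu, heu⟩)
        exact ⟨f, Finset.mem_insert_of_mem hf, hfu⟩
    · intro u hu u' hu' hne
      rcases Finset.mem_insert.1 hu with rfl | hu <;> rcases Finset.mem_insert.1 hu' with rfl | hu'
      · exact absurd rfl hne
      · exact hdt u' hu'
      · exact (hdt u ‹u ∈ T›).symm
      · exact hd u hu u' hu' hne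
    · rw [Finset.card_insert_of_notMem fun h => htS' (hT h)]
      exact (Finset.card_insert_le _ _).trans (by omega)

/-- If every nonempty family of triangles outside `L` has a member sharing at most one of its edges
with other members, then `τ ≤ ν + |L|`. -/
theorem tau_le_nu_add_card [Nonempty V] {s : Finset (Sym2 V)} (hs : s ⊆ pairs V) (L : Finset (Finset V))
    (hleaf : ∀ S' ⊆ triangles s \ L, S'.Nonempty → ∃ t ∈ S', ∃ e ∈ spannedEdges t,
      ∀ t' ∈ S', t' ≠ t → ∀ f ∈ spannedEdges t, f ∈ spannedEdges t' → f = e) :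
    tau (graphOf s) ≤ nu (graphOf s) + L.card := by
  have hsub : triangles s \ L ⊆ triangles s := Finset.sdiff_subset
  obtain ⟨F, T, hT, hFS, hcov, hd, hc⟩ := exists_cover_le_matching _
    (fun t ht => (mem_triangles.1 (hsub ht)).1) hleaf
  have hex : ∀ t ∈ triangles s, ∃ e, e ∈ spannedEdges t := fun t ht =>
    exists_mem_spannedEdges (mem_triangles.1 ht).1
  have : Nonempty (Sym2 V) := ⟨s(Classical.arbitrary V, Classical.arbitrary V)⟩
  choose! f hf using hex
  have hle : tau (graphOf s) ≤ (F ∪ (L ∩ triangles s).image f).card := by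
    refine tau_le_card hs (Finset.union_subset ?_ ?_) fun t ht => ?_
    · intro e he
      obtain ⟨t, ht, het⟩ := hFS e he
      exact (mem_triangles.1 (hsub ht)).2 (mem_innerPairs.2 het)
    · intro e he
      obtain ⟨t, ht, rfl⟩ := Finset.mem_image.1 he
      have ht := (Finset.mem_inter.1 ht).2
      exact (mem_triangles.1 ht).2 (mem_innerPairs.2 (hf t ht))
    · by_cases htL : t ∈ L
      · exact ⟨f t, Finset.mem_union_right _
          (Finset.mem_image_of_mem f (Finset.mem_inter.2 ⟨htL, ht⟩)), hf t ht⟩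
      · obtain ⟨e, he, het⟩ := hcov t (Finset.mem_sdiff.2 ⟨ht, htL⟩)
        exact ⟨e, Finset.mem_union_left _ he, het⟩
  have h₁ := Finset.card_union_le F ((L ∩ triangles s).image f)
  have h₂ : ((L ∩ triangles s).image f).card ≤ _ := Finset.card_image_le
  have h₃ := Finset.card_le_card (Finset.inter_subset_left : L ∩ triangles s ⊆ L)
  have h₄ := card_le_nu (hT.trans hsub) hd
  omega

end Triangles

/-! ### Stacked walks and closing triangles -/

section Walks

/-- A sequence of triangles, each of them glued along an edge of its predecessor, through a new
vertex: its edges, its vertices, and the last triangle `{fst, snd, tip}`, where `tip` is the last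
vertex added. -/
structure StackedWalk (V : Type*) where
  edges : Finset (Sym2 V)
  verts : Finset V
  fst : V
  snd : V
  tip : V

noncomputable instance (V : Type*) : DecidableEq (StackedWalk V) := Classical.decEq _

variable (V : Type*) [Fintype V] [DecidableEq V]

/-- The ordered triples of distinct vertices. -/
def distinctTriples : Finset (V × V × V) := {x | x.1 ≠ x.2.1 ∧ x.1 ≠ x.2.2 ∧ x.2.1 ≠ x.2.2}

variable {V}

/-- The one-triangle walk. -/
def StackedWalk.start (x : V × V × V) : StackedWalk V :=
  ⟨{s(x.1, x.2.1), s(x.1, x.2.2), s(x.2.1, x.2.2)}, {x.1, x.2.1, x.2.2}, x.1, x.2.1, x.2.2⟩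

/-- The walk extended by the triangle on the edge `{x.1, tip}` and the vertex `x.2`. -/
def StackedWalk.extend (σ : StackedWalk V) (x : V × V) : StackedWalk V :=
  ⟨insert s(x.2, x.1) (insert s(x.2, σ.tip) σ.edges), insert x.2 σ.verts, x.1, σ.tip, x.2⟩

variable (V) in
/-- The stacked walks of `k + 1` triangles. -/
noncomputable def stackedWalks : ℕ → Finset (StackedWalk V)
  | 0 => (distinctTriples V).image StackedWalk.start
  | k + 1 => (stackedWalks k).biUnion fun σ =>
      ((({σ.fst, σ.snd} : Finset V) ×ˢ (Finset.univ \ σ.verts)).image σ.extend)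

variable (V) in
/-- The stacked walks of `k + 1` triangles closed by a further triangle at the last tip and an old
vertex: the set of edges including the one between these two, and the closing triangle. -/
noncomputable def closedWalks (k : ℕ) : Finset (Finset (Sym2 V) × Finset V) :=
  (stackedWalks V k).biUnion fun σ =>
    ((({σ.fst, σ.snd} : Finset V) ×ˢ (σ.verts \ {σ.fst, σ.snd, σ.tip})).image fun x =>
      (insert s(σ.tip, x.2) σ.edges, {x.1, σ.tip, x.2}))

/-- The properties of a stacked walk of `k + 1` triangles. -/
structure StackedWalk.Valid (k : ℕ) (σ : StackedWalk V) : Prop where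
  card_edges : σ.edges.card = 3 + 2 * k
  card_verts : σ.verts.card = k + 3
  edges_subset : σ.edges ⊆ pairs V
  mem_verts : ∀ e ∈ σ.edges, ∀ v ∈ e, v ∈ σ.verts
  fst_mem : σ.fst ∈ σ.verts
  snd_mem : σ.snd ∈ σ.verts
  tip_mem : σ.tip ∈ σ.verts
  fst_ne_snd : σ.fst ≠ σ.snd
  fst_ne_tip : σ.fst ≠ σ.tip
  snd_ne_tip : σ.snd ≠ σ.tip
  eq_of_tip : ∀ v, s(σ.tip, v) ∈ σ.edges → v = σ.fst ∨ v = σ.snd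

theorem StackedWalk.valid_start {x : V × V × V} (hx : x ∈ distinctTriples V) :
    (StackedWalk.start x).Valid 0 := by
  obtain ⟨a, b, c⟩ := x
  simp only [distinctTriples, Finset.mem_filter, Finset.mem_univ, true_and] at hx
  obtain ⟨hab, hac, hbc⟩ := hx
  constructor <;> simp only [StackedWalk.start]
  · rw [Finset.card_eq_three.2 ⟨_, _, _, ?_, ?_, ?_, rfl⟩] <;> grind
  · rw [Finset.card_eq_three.2 ⟨_, _, _, hab, hac, hbc, rfl⟩]
  · intro e he
    simp only [Finset.mem_insert, Finset.mem_singleton] at he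
    rcases he with rfl | rfl | rfl <;> simp [pairs, *]
  · intro e he v hv
    simp only [Finset.mem_insert, Finset.mem_singleton] at he
    rcases he with rfl | rfl | rfl <;> simp only [Sym2.mem_iff] at hv <;>
      rcases hv with rfl | rfl <;> simp
  · simp
  · simp
  · simp
  · exact hab
  · exact hac
  · exact hbc
  · intro v hv
    simp only [Finset.mem_insert, Finset.mem_singleton, Sym2.eq_iff] at hv
    grind

/-- The added vertex lies on no earlier edge, so both added edges are new and they are the only ones
at the new tip. -/
theorem StackedWalk.Valid.extend {k : ℕ} {σ : StackedWalk V} (h : σ.Valid k) {x : V × V}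
    (hx : x.1 = σ.fst ∨ x.1 = σ.snd) (hx' : x.2 ∉ σ.verts) : (σ.extend x).Valid (k + 1) := by
  obtain ⟨y, z⟩ := x
  simp only at hx hx'
  have hy : y ∈ σ.verts := by rcases hx with rfl | rfl; exacts [h.fst_mem, h.snd_mem]
  have hyt : y ≠ σ.tip := by rcases hx with rfl | rfl; exacts [h.fst_ne_tip, h.snd_ne_tip]
  have hyz : y ≠ z := fun e => hx' (e ▸ hy)
  have htz : σ.tip ≠ z := fun e => hx' (e ▸ h.tip_mem)
  have hnot : ∀ v, s(z, v) ∉ σ.edges := fun v hv => hx' (h.mem_verts _ hv z (by simp))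
  constructor <;> simp only [StackedWalk.extend]
  · rw [Finset.card_insert_of_notMem, Finset.card_insert_of_notMem (hnot _), h.card_edges]
    · ring
    · simp only [Finset.mem_insert, not_or]
      exact ⟨by rw [Sym2.eq_iff]; grind, hnot _⟩
  · rw [Finset.card_insert_of_notMem hx', h.card_verts]
  · intro e he
    simp only [Finset.mem_insert] at he
    rcases he with rfl | rfl | he
    · simp [pairs, hyz.symm]
    · simp [pairs, htz.symm]
    · exact h.edges_subset he
  · intro e he v hv
    simp only [Finset.mem_insert] at he
    rcases he with rfl | rfl | he
    · rcases Sym2.mem_iff.1 hv with rfl | rfl <;> simp [hy]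
    · rcases Sym2.mem_iff.1 hv with rfl | rfl <;> simp [h.tip_mem]
    · exact Finset.mem_insert_of_mem (h.mem_verts e he v hv)
  · exact Finset.mem_insert_of_mem hy
  · exact Finset.mem_insert_of_mem h.tip_mem
  · exact Finset.mem_insert_self _ _
  · exact hyt
  · exact hyz
  · exact htz
  · intro v hv
    simp only [Finset.mem_insert, hnot, or_false, Sym2.eq_iff] at hv
    grind

theorem valid_of_mem_stackedWalks {k : ℕ} {σ : StackedWalk V} (h : σ ∈ stackedWalks V k) :
    σ.Valid k := by
  induction k generalizing σ with
  | zero =>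
    obtain ⟨x, hx, rfl⟩ := Finset.mem_image.1 h
    exact StackedWalk.valid_start hx
  | succ k ih =>
    obtain ⟨ρ, hρ, h⟩ := Finset.mem_biUnion.1 h
    obtain ⟨x, hx, rfl⟩ := Finset.mem_image.1 h
    rw [Finset.mem_product] at hx
    exact (ih hρ).extend (by simpa using hx.1) (by simpa using hx.2)

/-- Each extension chooses one of two edges at the tip and a vertex outside the walk. -/
theorem card_stackedWalks_le (k : ℕ) : (stackedWalks V k).card ≤
    (distinctTriples V).card * (2 * (Fintype.card V - 2)) ^ k := by
  induction k with
  | zero => simpa [stackedWalks] using Finset.card_image_le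
  | succ k ih =>
    rw [stackedWalks, pow_succ, ← mul_assoc]
    refine (Finset.card_biUnion_le_card_mul _ _ _ fun σ hσ => ?_).trans
      (Nat.mul_le_mul_right _ ih)
    refine Finset.card_image_le.trans ?_
    rw [Finset.card_product, Finset.card_sdiff_of_subset (Finset.subset_univ _),
      (valid_of_mem_stackedWalks hσ).card_verts, Finset.card_univ]
    exact Nat.mul_le_mul Finset.card_le_two (by omega)

theorem card_closedWalks_le (k : ℕ) : (closedWalks V k).card ≤
    (distinctTriples V).card * (2 * (Fintype.card V - 2)) ^ k * (2 * k) := by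
  refine (Finset.card_biUnion_le_card_mul _ _ (2 * k) fun σ hσ => ?_).trans
    (Nat.mul_le_mul_right _ (card_stackedWalks_le k))
  have h := valid_of_mem_stackedWalks hσ
  refine Finset.card_image_le.trans ?_
  rw [Finset.card_product, Finset.card_sdiff_of_subset, h.card_verts,
    Finset.card_eq_three.2 ⟨_, _, _, h.fst_ne_snd, h.fst_ne_tip, h.snd_ne_tip, rfl⟩]
  · exact Nat.mul_le_mul Finset.card_le_two (by omega)
  · simp [Finset.insert_subset_iff, h.fst_mem, h.snd_mem, h.tip_mem]

/-- The edge from the tip to the old vertex is new, because the tip is joined within the walk only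
to `fst` and `snd`. The third side of the closing triangle may be old or new and is not counted. -/
theorem closedWalks_edges {k : ℕ} {c : Finset (Sym2 V) × Finset V} (hc : c ∈ closedWalks V k) :
    c.1 ⊆ pairs V ∧ c.1.card = 4 + 2 * k := by
  obtain ⟨σ, hσ, hc⟩ := Finset.mem_biUnion.1 hc
  obtain ⟨x, hx, rfl⟩ := Finset.mem_image.1 hc
  have h := valid_of_mem_stackedWalks hσ
  simp only [Finset.mem_product, Finset.mem_sdiff, Finset.mem_insert, Finset.mem_singleton,
    not_or] at hx
  obtain ⟨-, hx, h₁, h₂, h₃⟩ := hx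
  refine ⟨Finset.insert_subset (by simp [pairs, Ne.symm h₃]) h.edges_subset, ?_⟩
  rw [Finset.card_insert_of_notMem, h.card_edges]
  · ring
  · intro hmem
    rcases h.eq_of_tip _ hmem with e | e
    exacts [h₁ e, h₂ e]

/-- The closing triangles of the closed walks in the graph with edge set `s`. -/
noncomputable def closingTriangles (s : Finset (Sym2 V)) : Finset (Finset V) :=
  (Finset.range (Fintype.card V)).biUnion fun k =>
    ({c ∈ closedWalks V k | c.1 ⊆ s}).image Prod.snd

/-- Without leaves the walk can always be continued inside `S`, and a step onto an old vertex would
be a closing triangle, which `S` excludes. -/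
theorem exists_mem_stackedWalks_of_no_leaf {s : Finset (Sym2 V)} {S : Finset (Finset V)}
    (hS : S ⊆ triangles s \ closingTriangles s) (hne : S.Nonempty)
    (hleaf : ∀ t ∈ S, ∀ e ∈ spannedEdges t, ∃ t' ∈ S, t' ≠ t ∧
      ∃ f ∈ spannedEdges t, f ∈ spannedEdges t' ∧ f ≠ e) (k : ℕ) :
    ∃ σ ∈ stackedWalks V k, σ.edges ⊆ s ∧ ({σ.fst, σ.snd, σ.tip} : Finset V) ∈ S := by
  have hadj : ∀ t ∈ S, ∀ a ∈ t, ∀ b ∈ t, a ≠ b → s(a, b) ∈ s := fun t ht a ha b hb hab =>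
    (mem_triangles.1 (Finset.mem_sdiff.1 (hS ht)).1).2
      (mem_innerPairs.2 (mk_mem_spannedEdges.2 ⟨hab, ha, hb⟩))
  have hcard : ∀ t ∈ S, t.card = 3 := fun t ht =>
    (mem_triangles.1 (Finset.mem_sdiff.1 (hS ht)).1).1
  induction k with
  | zero =>
    obtain ⟨t, ht⟩ := hne
    obtain ⟨a, b, c, hab, hac, hbc, rfl⟩ := Finset.card_eq_three.1 (hcard t ht)
    refine ⟨StackedWalk.start (a, b, c), Finset.mem_image_of_mem _ (by
      simp [distinctTriples, hab, hac, hbc]), ?_, ht⟩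
    simp only [StackedWalk.start, Finset.insert_subset_iff, Finset.singleton_subset_iff]
    exact ⟨hadj _ ht a (by simp) b (by simp) hab, hadj _ ht a (by simp) c (by simp) hac,
      hadj _ ht b (by simp) c (by simp) hbc⟩
  | succ k ih =>
    obtain ⟨σ, hσ, hσs, hσS⟩ := ih
    have h := valid_of_mem_stackedWalks hσ
    -- Exempting the edge opposite the tip forces the shared edge to contain the tip.
    obtain ⟨t', ht', hne', f, hf, hf', hfe⟩ := hleaf _ hσS s(σ.fst, σ.snd)
      (mk_mem_spannedEdges.2 ⟨h.fst_ne_snd, by simp, by simp⟩)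
    obtain ⟨x, hx, rfl⟩ : ∃ x, (x = σ.fst ∨ x = σ.snd) ∧ f = s(x, σ.tip) := by
      induction f with
      | _ u v =>
        rw [mk_mem_spannedEdges] at hf
        simp only [Finset.mem_insert, Finset.mem_singleton] at hf
        obtain ⟨huv, rfl | rfl | rfl, rfl | rfl | rfl⟩ := hf
        · exact absurd rfl huv
        · exact absurd rfl hfe
        · exact ⟨_, Or.inl rfl, rfl⟩
        · exact absurd Sym2.eq_swap hfe
        · exact absurd rfl huv
        · exact ⟨_, Or.inr rfl, rfl⟩
        · exact ⟨_, Or.inl rfl, Sym2.eq_swap⟩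
        · exact ⟨_, Or.inr rfl, Sym2.eq_swap⟩
        · exact absurd rfl huv
    obtain ⟨hxt, hxt', htt'⟩ := mk_mem_spannedEdges.1 hf'
    obtain ⟨z, hz⟩ : ∃ z, t' \ {x, σ.tip} = {z} := by
      rw [← Finset.card_eq_one, Finset.card_sdiff_of_subset (by
        simp [Finset.insert_subset_iff, hxt', htt']), hcard t' ht', Finset.card_pair hxt]
    have hz' : z ∈ t' ∧ z ≠ x ∧ z ≠ σ.tip := by
      have : z ∈ t' \ {x, σ.tip} := by simp [hz]
      simpa using this
    have ht'eq : t' = {x, σ.tip, z} := by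
      have := Finset.sdiff_union_of_subset (show {x, σ.tip} ⊆ t' by
        simp [Finset.insert_subset_iff, hxt', htt'])
      rw [← this, hz]
      ext; simp; tauto
    by_cases hzU : z ∈ σ.verts
    · exfalso
      have hzn : z ∉ ({σ.fst, σ.snd, σ.tip} : Finset V) := by
        intro hzm
        apply hne'
        rw [ht'eq]
        simp only [Finset.mem_insert, Finset.mem_singleton] at hzm
        ext v
        simp only [Finset.mem_insert, Finset.mem_singleton]
        grind
      have hk : k < Fintype.card V := by
        have := Finset.card_le_univ σ.verts
        rw [h.card_verts] at this
        omega
      refine (Finset.mem_sdiff.1 (hS ht')).2 (Finset.mem_biUnion.2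
        ⟨k, Finset.mem_range.2 hk, Finset.mem_image.2
          ⟨(insert s(σ.tip, z) σ.edges, {x, σ.tip, z}), Finset.mem_filter.2 ⟨?_, ?_⟩, ht'eq.symm⟩⟩)
      · exact Finset.mem_biUnion.2 ⟨σ, hσ, Finset.mem_image.2 ⟨(x, z), Finset.mem_product.2
          ⟨by simpa using hx, Finset.mem_sdiff.2 ⟨hzU, hzn⟩⟩, rfl⟩⟩
      · exact Finset.insert_subset (hadj t' ht' _ htt' _ hz'.1 hz'.2.2.symm) hσs
    · refine ⟨σ.extend (x, z), Finset.mem_biUnion.2 ⟨σ, hσ, Finset.mem_image_of_mem _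
        (Finset.mem_product.2 ⟨by simpa using hx, by simpa using hzU⟩)⟩, ?_, ht'eq ▸ ht'⟩
      exact Finset.insert_subset (hadj t' ht' _ hz'.1 _ hxt' hz'.2.1)
        (Finset.insert_subset (hadj t' ht' _ hz'.1 _ htt' hz'.2.2) hσs)

theorem tau_le_nu_add_card_closingTriangles [Nonempty V] {s : Finset (Sym2 V)} (hs : s ⊆ pairs V) :
    tau (graphOf s) ≤ nu (graphOf s) + (closingTriangles s).card := by
  refine tau_le_nu_add_card hs _ fun S hS hne => ?_
  by_contra! hleaf
  -- Such a walk would have `Fintype.card V + 3` distinct vertices.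
  obtain ⟨σ, hσ, -⟩ := exists_mem_stackedWalks_of_no_leaf hS hne hleaf (Fintype.card V)
  have := Finset.card_le_univ σ.verts
  rw [(valid_of_mem_stackedWalks hσ).card_verts] at this
  omega

theorem card_closingTriangles_le (s : Finset (Sym2 V)) :
    ((closingTriangles s).card : ℝ) ≤ ∑ k ∈ Finset.range (Fintype.card V),
      ∑ c ∈ closedWalks V k, if c.1 ⊆ s then 1 else 0 := by
  have : (closingTriangles s).card ≤ ∑ k ∈ Finset.range (Fintype.card V),
      ({c ∈ closedWalks V k | c.1 ⊆ s}).card :=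
    Finset.card_biUnion_le.trans (Finset.sum_le_sum fun k _ => Finset.card_image_le)
  calc ((closingTriangles s).card : ℝ) ≤ _ := Nat.cast_le.2 this
    _ = _ := by push_cast [Finset.card_filter]; rfl

theorem card_distinctTriples :
    (distinctTriples V).card ≤ 6 * (Fintype.card V).choose 3 := by
  have hsub : distinctTriples V ⊆ (Finset.univ : Finset V).biUnion fun a =>
      ((Finset.univ.erase a).offDiag).image (Prod.mk a) := by
    rintro ⟨a, b, c⟩ h
    simp only [distinctTriples, Finset.mem_filter, Finset.mem_univ, true_and] at h
    simp [h.1.symm, h.2.1.symm, h.2.2]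
  refine (Finset.card_le_card hsub).trans ((Finset.card_biUnion_le_card_mul _ _
    ((Fintype.card V - 1) * (Fintype.card V - 2)) fun a _ => ?_).trans ?_)
  · refine Finset.card_image_le.trans ?_
    rw [Finset.offDiag_card, Finset.card_erase_of_mem (Finset.mem_univ a), Finset.card_univ,
      ← Nat.mul_sub_one]
    rfl
  · have := Nat.descFactorial_eq_factorial_mul_choose (Fintype.card V) 3
    simp only [Nat.descFactorial_succ, Nat.descFactorial_zero] at this
    rw [show Nat.factorial 3 = 6 from rfl] at this
    rw [← this, Finset.card_univ]
    apply le_of_eq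
    simp only [Nat.sub_zero, mul_one]
    ring

end Walks

/-! ### Expected gap between `τ` and `ν` -/

section Moments

variable {V : Type*} [Fintype V] [DecidableEq V]

theorem innerPairs_subset_pairs (t : Finset V) : innerPairs t ⊆ pairs V := Finset.filter_subset _ _

theorem innerPairs_inter (t t' : Finset V) :
    innerPairs t ∩ innerPairs t' = innerPairs (t ∩ t') := by
  ext e
  simp only [innerPairs, Finset.mem_inter, Finset.mem_filter]
  grind

theorem card_triangles_eq_sum (s : Finset (Sym2 V)) : ((triangles s).card : ℝ) =
    ∑ t ∈ (Finset.univ : Finset V).powersetCard 3, if innerPairs t ⊆ s then 1 else 0 := by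
  rw [triangles, Finset.sum_boole]

theorem bernoulliExp_card_triangles (p : ℝ) :
    bernoulliExp p (pairs V) (fun s => ((triangles s).card : ℝ)) =
      (Fintype.card V).choose 3 * p ^ 3 := by
  simp only [card_triangles_eq_sum]
  rw [bernoulliExp_sum, Finset.sum_congr rfl fun t ht => ?_, Finset.sum_const,
    Finset.card_powersetCard, Finset.card_univ, nsmul_eq_mul]
  rw [bernoulliExp_subset p (innerPairs_subset_pairs t), card_innerPairs,
    (Finset.mem_powersetCard.1 ht).2]
  rfl

theorem sum_range_mul_pow_le {x r : ℝ} (hx : 0 ≤ x) (hxr : x ≤ r) (hr : r < 1) (n : ℕ) :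
    ∑ k ∈ Finset.range n, (k : ℝ) * x ^ k ≤ 1 / (1 - r) ^ 2 := by
  have hr₀ := hx.trans hxr
  have h := hasSum_coe_mul_geometric_of_norm_lt_one (𝕜 := ℝ) (r := r)
    (by rwa [Real.norm_of_nonneg hr₀])
  calc ∑ k ∈ Finset.range n, (k : ℝ) * x ^ k ≤ ∑ k ∈ Finset.range n, (k : ℝ) * r ^ k := by
        gcongr
    _ ≤ r / (1 - r) ^ 2 := sum_le_hasSum _ (fun _ _ => by positivity) h
    _ ≤ 1 / (1 - r) ^ 2 := by gcongr

/-- The walks with parameter `k` contribute at most `12 C(n,3) p^4 · k (2d)^k`: the surplus edge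
gives the fourth power of `p`, and `12` is `6` orderings times the `2` in the `2k` ways to close. -/
theorem bernoulliExp_card_closingTriangles_le {p r : ℝ} (hp₀ : 0 ≤ p) (hp₁ : p ≤ 1)
    (hV : 2 ≤ Fintype.card V) (hr : 2 * (((Fintype.card V : ℝ) - 2) * p ^ 2) ≤ r) (hr₁ : r < 1) :
    bernoulliExp p (pairs V) (fun s => ((closingTriangles s).card : ℝ)) ≤
      12 * ((Fintype.card V).choose 3 * p ^ 4) / (1 - r) ^ 2 := by
  refine (bernoulliExp_le hp₀ hp₁ fun s _ => card_closingTriangles_le s).trans ?_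
  simp only [bernoulliExp_sum]
  have hcast : ((Fintype.card V - 2 : ℕ) : ℝ) = (Fintype.card V : ℝ) - 2 := by
    push_cast [Nat.cast_sub hV]; rfl
  have hV' : (0 : ℝ) ≤ (Fintype.card V : ℝ) - 2 := by rw [← hcast]; positivity
  have hk : ∀ k ∈ Finset.range (Fintype.card V), ∑ c ∈ closedWalks V k,
      bernoulliExp p (pairs V) (fun s => if c.1 ⊆ s then 1 else 0) ≤
      12 * ((Fintype.card V).choose 3 * p ^ 4) *
        (k * (2 * (((Fintype.card V : ℝ) - 2) * p ^ 2)) ^ k) := by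
    intro k _
    rw [Finset.sum_congr rfl fun c hc => by
      rw [bernoulliExp_subset p (closedWalks_edges hc).1, (closedWalks_edges hc).2],
      Finset.sum_const, nsmul_eq_mul]
    have h₁ : ((closedWalks V k).card : ℝ) ≤
        6 * (Fintype.card V).choose 3 * (2 * ((Fintype.card V : ℝ) - 2)) ^ k * (2 * k) := by
      rw [← hcast]
      exact_mod_cast (card_closedWalks_le k).trans
        (Nat.mul_le_mul_right _ (Nat.mul_le_mul_right _ card_distinctTriples))
    calc _ ≤ 6 * (Fintype.card V).choose 3 * (2 * ((Fintype.card V : ℝ) - 2)) ^ k * (2 * k) *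
          p ^ (4 + 2 * k) := by gcongr
      _ = _ := by rw [pow_add, pow_mul, ← mul_assoc 2, mul_pow _ (p ^ 2)]; ring
  refine (Finset.sum_le_sum hk).trans ?_
  rw [← Finset.mul_sum, div_eq_mul_one_div]
  exact mul_le_mul_of_nonneg_left (sum_range_mul_pow_le (by positivity) hr hr₁ _) (by positivity)

/-- The expectation of `τ - ν` is small compared to the expected number of triangles. -/
theorem bernoulliExp_tau_sub_nu_le [Nonempty V] {p δ : ℝ} (hp₀ : 0 ≤ p) (hp₁ : p ≤ 1)
    (hV : 2 ≤ Fintype.card V) (hd : ((Fintype.card V : ℝ) - 2) * p ^ 2 ≤ 1 / 2)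
    (hδ₀ : 0 < δ) (hδ₁ : δ ≤ 1) :
    bernoulliExp p (pairs V) (fun s => (tau (graphOf s) : ℝ) - nu (graphOf s)) ≤
      (Fintype.card V).choose 3 * p ^ 3 * (3 * δ + 12 * p / δ ^ 2) := by
  set q := (1 - δ) * p with hq
  have hδ' : 0 ≤ 1 - δ := by linarith
  have hq₀ : 0 ≤ q := by positivity
  have hqp : q ≤ p := by rw [hq]; nlinarith
  -- The number of triangles minus `τ` increases with the edge set, so `τ` gains no more in
  -- expectation than the triangle count does.
  have hmono₁ := bernoulliExp_mono hq₀ hqp hp₁ (D := pairs V)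
    (f := fun s => ((triangles s).card : ℝ) - tau (graphOf s)) fun s t hst ht => by
      have : (tau (graphOf t) : ℝ) + (triangles s).card ≤ tau (graphOf s) + (triangles t).card :=
        mod_cast tau_add_card_triangles_le hst ht
      linarith
  have hmono₂ := bernoulliExp_mono hq₀ hqp hp₁ (D := pairs V)
    (f := fun s => (nu (graphOf s) : ℝ)) fun s t hst _ => mod_cast nu_mono hst
  have hclosed : bernoulliExp q (pairs V)
      (fun s => (tau (graphOf s) : ℝ) - nu (graphOf s)) ≤
      12 * ((Fintype.card V).choose 3 * q ^ 4) / (1 - (1 - δ) ^ 2) ^ 2 := by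
    refine (bernoulliExp_le hq₀ (hqp.trans hp₁) fun s hs => ?_).trans
      (bernoulliExp_card_closingTriangles_le (V := V) hq₀ (hqp.trans hp₁) hV ?_ ?_)
    · have : (tau (graphOf s) : ℝ) ≤ nu (graphOf s) + (closingTriangles s).card :=
        mod_cast tau_le_nu_add_card_closingTriangles hs
      linarith
    · rw [hq, mul_pow]
      nlinarith [sq_nonneg (1 - δ)]
    · nlinarith
  rw [bernoulliExp_sub, bernoulliExp_sub, bernoulliExp_card_triangles,
    bernoulliExp_card_triangles] at hmono₁
  rw [bernoulliExp_sub] at hclosed ⊢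
  have hC : (0 : ℝ) ≤ (Fintype.card V).choose 3 := by positivity
  have h₁ : ((Fintype.card V).choose 3 : ℝ) * p ^ 3 - (Fintype.card V).choose 3 * q ^ 3 ≤
      (Fintype.card V).choose 3 * p ^ 3 * (3 * δ) := by
    have : 1 - (1 - δ) ^ 3 ≤ 3 * δ := by nlinarith [mul_nonneg hδ₀.le hδ₀.le]
    calc _ = (Fintype.card V).choose 3 * p ^ 3 * (1 - (1 - δ) ^ 3) := by rw [hq]; ring
      _ ≤ _ := by gcongr
  have h₂ : 12 * ((Fintype.card V).choose 3 * q ^ 4) / (1 - (1 - δ) ^ 2) ^ 2 ≤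
      (Fintype.card V).choose 3 * p ^ 3 * (12 * p / δ ^ 2) := by
    have : δ ≤ 1 - (1 - δ) ^ 2 := by nlinarith
    calc _ ≤ 12 * ((Fintype.card V).choose 3 * p ^ 4) / δ ^ 2 := by gcongr
      _ = _ := by ring
  linarith

/-! ### Second moment and lower tail of `ν` -/

variable (V) in
/-- The ordered pairs of three-element sets with two common elements. -/
def sharingPairs : Finset (Finset V × Finset V) :=
  {x ∈ (Finset.univ.powersetCard 3) ×ˢ (Finset.univ.powersetCard 3) | (x.1 ∩ x.2).card = 2}

/-- The second set arises from the first by exchanging one of its three vertices for an outside one.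
-/
theorem card_sharingPairs_le : (sharingPairs V).card ≤
    (Fintype.card V).choose 3 * (3 * (Fintype.card V - 3)) := by
  have hsub : sharingPairs V ⊆ (Finset.univ.powersetCard 3).biUnion fun t =>
      (t ×ˢ (Finset.univ \ t)).image fun x => (t, insert x.2 (t.erase x.1)) := by
    rintro ⟨t, t'⟩ h
    simp only [sharingPairs, Finset.mem_filter, Finset.mem_product, Finset.mem_powersetCard,
      Finset.subset_univ, true_and] at h
    obtain ⟨⟨ht, ht'⟩, hi⟩ := h
    obtain ⟨x, hx⟩ : ∃ x, t \ t' = {x} := by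
      rw [← Finset.card_eq_one]
      have := Finset.card_sdiff_add_card_inter t t'
      omega
    obtain ⟨z, hz⟩ : ∃ z, t' \ t = {z} := by
      rw [← Finset.card_eq_one]
      have := Finset.card_sdiff_add_card_inter t' t
      rw [Finset.inter_comm] at this
      omega
    simp only [Finset.ext_iff, Finset.mem_sdiff, Finset.mem_singleton] at hx hz
    refine Finset.mem_biUnion.2 ⟨t, by simpa using ht, Finset.mem_image.2 ⟨(x, z), ?_, ?_⟩⟩
    · simp only [Finset.mem_product, Finset.mem_sdiff, Finset.mem_univ, true_and]
      exact ⟨((hx x).2 rfl).1, ((hz z).2 rfl).2⟩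
    · simp only [Prod.mk.injEq, true_and]
      ext v
      have := hx v
      have := hz v
      simp only [Finset.mem_insert, Finset.mem_erase]
      tauto
  refine (Finset.card_le_card hsub).trans ((Finset.card_biUnion_le_card_mul _ _
    (3 * (Fintype.card V - 3)) fun t ht => ?_).trans ?_)
  · have ht := (Finset.mem_powersetCard.1 ht).2
    refine Finset.card_image_le.trans ?_
    rw [Finset.card_product, Finset.card_sdiff_of_subset (Finset.subset_univ _), ht,
      Finset.card_univ]
  · rw [Finset.card_powersetCard, Finset.card_univ]

/-- The number of ordered pairs of triangles that share an edge. -/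
noncomputable def sharingCount (s : Finset (Sym2 V)) : ℝ :=
  ∑ x ∈ sharingPairs V, if innerPairs x.1 ∪ innerPairs x.2 ⊆ s then 1 else 0

theorem card_union_innerPairs {t t' : Finset V} (ht : t.card = 3) (ht' : t'.card = 3) :
    (innerPairs t ∪ innerPairs t').card = 6 - (t ∩ t').card.choose 2 := by
  have := Finset.card_union_add_card_inter (innerPairs t) (innerPairs t')
  rw [innerPairs_inter, card_innerPairs, card_innerPairs, card_innerPairs, ht, ht',
    show Nat.choose 3 2 = 3 from rfl] at this
  omega

theorem bernoulliExp_sharingCount (p : ℝ) :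
    bernoulliExp p (pairs V) sharingCount = (sharingPairs V).card * p ^ 5 := by
  unfold sharingCount
  rw [bernoulliExp_sum, Finset.sum_congr rfl fun x hx => ?_, Finset.sum_const, nsmul_eq_mul]
  simp only [sharingPairs, Finset.mem_filter, Finset.mem_product, Finset.mem_powersetCard] at hx
  rw [bernoulliExp_subset p (Finset.union_subset (innerPairs_subset_pairs _)
    (innerPairs_subset_pairs _)), card_union_innerPairs hx.1.1.2 hx.1.2.2, hx.2]
  rfl

theorem bernoulliExp_sharingCount_le {p : ℝ} (hp₀ : 0 ≤ p) (hV : 2 ≤ Fintype.card V) :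
    bernoulliExp p (pairs V) sharingCount ≤
      (Fintype.card V).choose 3 * p ^ 3 * (3 * (((Fintype.card V : ℝ) - 2) * p ^ 2)) := by
  rw [bernoulliExp_sharingCount]
  have h₁ : ((sharingPairs V).card : ℝ) ≤
      (Fintype.card V).choose 3 * (3 * ((Fintype.card V : ℝ) - 2)) := by
    have hcast : ((Fintype.card V - 2 : ℕ) : ℝ) = (Fintype.card V : ℝ) - 2 := by
      push_cast [Nat.cast_sub hV]; rfl
    rw [← hcast]
    exact_mod_cast card_sharingPairs_le.trans (Nat.mul_le_mul_left _ (by omega))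
  calc _ ≤ (Fintype.card V).choose 3 * (3 * ((Fintype.card V : ℝ) - 2)) * p ^ 5 := by gcongr
    _ = _ := by ring

omit [Fintype V] in
theorem card_inter_eq_two {t t' : Finset V} (ht : t.card = 3) (ht' : t'.card = 3) (hne : t ≠ t')
    (h : 2 ≤ (t ∩ t').card) : (t ∩ t').card = 2 := by
  have h₁ := Finset.card_le_card (Finset.inter_subset_left : t ∩ t' ⊆ t)
  by_contra h₂
  have h₃ : (t ∩ t').card = 3 := by omega
  exact hne ((Finset.eq_of_subset_of_card_le Finset.inter_subset_left (by omega)).symm.trans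
    (Finset.eq_of_subset_of_card_le Finset.inter_subset_right (by omega)))

/-- Triangles sharing no edge form a matching; every other triangle is the first entry of a sharing
pair. -/
theorem card_triangles_le_nu_add (s : Finset (Sym2 V)) :
    ((triangles s).card : ℝ) ≤ nu (graphOf s) + sharingCount s := by
  classical
  set I := (triangles s).filter fun t =>
    ∀ t' ∈ triangles s, t ≠ t' → Disjoint (spannedEdges t) (spannedEdges t') with hI
  have h₁ : I.card ≤ nu (graphOf s) := card_le_nu (Finset.filter_subset _ _)
    fun t ht t' ht' => (Finset.mem_filter.1 ht).2 t' (Finset.mem_filter.1 ht').1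
  have h₂ : triangles s \ I ⊆
      ({x ∈ sharingPairs V | innerPairs x.1 ∪ innerPairs x.2 ⊆ s}).image Prod.fst := by
    intro t ht
    rw [Finset.mem_sdiff, hI, Finset.mem_filter] at ht
    obtain ⟨ht, h⟩ := ht
    push Not at h
    obtain ⟨t', ht', hne, hd⟩ := h ht
    obtain ⟨e, he, he'⟩ := Set.not_disjoint_iff.1 hd
    obtain ⟨hc, hs⟩ := mem_triangles.1 ht
    obtain ⟨hc', hs'⟩ := mem_triangles.1 ht'
    refine Finset.mem_image.2 ⟨(t, t'), Finset.mem_filter.2 ⟨?_, Finset.union_subset hs hs'⟩, rfl⟩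
    simp only [sharingPairs, Finset.mem_filter, Finset.mem_product, Finset.mem_powersetCard,
      Finset.subset_univ, true_and]
    refine ⟨⟨hc, hc'⟩, card_inter_eq_two hc hc' hne ?_⟩
    have hpos : 0 < (innerPairs (t ∩ t')).card := Finset.card_pos.2 ⟨e, by
      rw [← innerPairs_inter, Finset.mem_inter, mem_innerPairs, mem_innerPairs]
      exact ⟨he, he'⟩⟩
    rw [card_innerPairs] at hpos
    by_contra hlt
    rw [Nat.choose_eq_zero_of_lt (by omega)] at hpos
    omega
  have h₃ := (Finset.card_le_card h₂).trans Finset.card_image_le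
  have h₄ : (triangles s \ I).card + I.card = (triangles s).card :=
    Finset.card_sdiff_add_card_eq_card (Finset.filter_subset _ _)
  have h₅ : sharingCount s =
      ({x ∈ sharingPairs V | innerPairs x.1 ∪ innerPairs x.2 ⊆ s}).card := by
    rw [sharingCount, Finset.sum_boole]
  rw [h₅]
  exact_mod_cast (show (triangles s).card ≤ nu (graphOf s) + _ by omega)

theorem bernoulliExp_variance_triangles_le {p : ℝ} (hp₀ : 0 ≤ p) :
    bernoulliExp p (pairs V)
        (fun s => ((triangles s).card - (Fintype.card V).choose 3 * p ^ 3) ^ 2) ≤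
      (Fintype.card V).choose 3 * p ^ 3 + bernoulliExp p (pairs V) (sharingCount (V := V)) := by
  set μ : ℝ := (Fintype.card V).choose 3 * p ^ 3 with hμ
  have hsq : bernoulliExp p (pairs V) (fun s => ((triangles s).card : ℝ) ^ 2) ≤
      μ + bernoulliExp p (pairs V) (sharingCount (V := V)) + μ ^ 2 := by
    set K := (Finset.univ : Finset V).powersetCard 3
    have h₁ : ∀ s : Finset (Sym2 V), ((triangles s).card : ℝ) ^ 2 =
        ∑ x ∈ K ×ˢ K, if innerPairs x.1 ∪ innerPairs x.2 ⊆ s then 1 else 0 := by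
      intro s
      rw [card_triangles_eq_sum, sq, Finset.sum_mul_sum, Finset.sum_product]
      refine Finset.sum_congr rfl fun t _ => Finset.sum_congr rfl fun t' _ => ?_
      simp only [Finset.union_subset_iff]
      split_ifs <;> simp_all
    -- Allowing `p ^ 6` for every pair, not just the edge-disjoint ones, makes these terms sum to
    -- exactly `μ ^ 2`.
    have hle : ∀ x ∈ K ×ˢ K,
        bernoulliExp p (pairs V) (fun s => if innerPairs x.1 ∪ innerPairs x.2 ⊆ s then 1 else 0) ≤
        (if x.1 = x.2 then p ^ 3 else 0) + (if (x.1 ∩ x.2).card = 2 then p ^ 5 else 0)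
          + p ^ 6 := by
      rintro ⟨t, t'⟩ hx
      simp only [K, Finset.mem_product, Finset.mem_powersetCard, Finset.subset_univ,
        true_and] at hx
      rw [bernoulliExp_subset p (Finset.union_subset (innerPairs_subset_pairs _)
        (innerPairs_subset_pairs _)), card_union_innerPairs hx.1 hx.2]
      have h₃ := pow_nonneg hp₀ 3
      have h₅ := pow_nonneg hp₀ 5
      have h₆ := pow_nonneg hp₀ 6
      by_cases he : t = t'
      · subst he
        simp only [Finset.inter_self, hx.1, show 6 - Nat.choose 3 2 = 3 from rfl, if_true]
        norm_num
        positivity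
      by_cases h2 : (t ∩ t').card = 2
      · simp only [h2, he, if_true, if_false, show 6 - Nat.choose 2 2 = 5 from rfl]
        linarith
      · have : (t ∩ t').card < 2 := by
          by_contra h
          exact h2 (card_inter_eq_two hx.1 hx.2 he (by omega))
        rw [Nat.choose_eq_zero_of_lt this]
        simp [he, h2]
    simp only [h₁]
    rw [bernoulliExp_sum]
    refine (Finset.sum_le_sum hle).trans (le_of_eq ?_)
    have hK : (K.card : ℝ) = (Fintype.card V).choose 3 := by
      simp [K, Finset.card_powersetCard]
    rw [Finset.sum_add_distrib, Finset.sum_add_distrib, bernoulliExp_sharingCount]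
    congr 1
    · congr 1
      · rw [Finset.sum_product]
        simp only [Finset.sum_ite_eq]
        rw [Finset.sum_congr rfl fun t ht => if_pos ht, Finset.sum_const, nsmul_eq_mul, hK]
      · rw [← Finset.sum_filter, Finset.sum_const, nsmul_eq_mul]
        rfl
    · rw [Finset.sum_const, Finset.card_product, nsmul_eq_mul, hμ]
      push_cast
      rw [hK]
      ring
  have hexp : bernoulliExp p (pairs V) (fun s => ((triangles s).card - μ) ^ 2) =
      bernoulliExp p (pairs V) (fun s => ((triangles s).card : ℝ) ^ 2) - μ ^ 2 := by
    rw [bernoulliExp_congr p (g := fun s =>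
      ((triangles s).card : ℝ) ^ 2 - (2 * μ) * (triangles s).card + μ ^ 2)
      (fun s _ => by ring), bernoulliExp_add, bernoulliExp_sub, bernoulliExp_const_mul,
      bernoulliExp_card_triangles, bernoulliExp_const]
    ring
  rw [hexp]
  linarith

/-- A lower tail bound for `ν`. -/
theorem bernoulliExp_nu_lt_le {p κ : ℝ} (hp₀ : 0 ≤ p) (hp₁ : p ≤ 1) (hV : 2 ≤ Fintype.card V)
    (hκ : 3 * (((Fintype.card V : ℝ) - 2) * p ^ 2) ≤ κ)
    (hμ₀ : 0 < (Fintype.card V).choose 3 * p ^ 3) :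
    bernoulliExp p (pairs V) (fun s => if (nu (graphOf s) : ℝ) <
        (Fintype.card V).choose 3 * p ^ 3 / 4 then 1 else 0) ≤
      4 * (1 + κ) / ((Fintype.card V).choose 3 * p ^ 3) + 4 * κ := by
  have hvar := bernoulliExp_variance_triangles_le (V := V) hp₀
  have hshare := bernoulliExp_sharingCount_le (V := V) hp₀ hV
  set μ : ℝ := (Fintype.card V).choose 3 * p ^ 3 with hμ
  have hshare' : bernoulliExp p (pairs V) (sharingCount (V := V)) ≤ μ * κ :=
    hshare.trans (by gcongr)
  -- If `ν < μ / 4`, either there are at most `μ / 2` triangles (Chebyshev) or more than `μ / 4`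
  -- sharing pairs (Markov).
  have hpt : ∀ s ⊆ pairs V, (if (nu (graphOf s) : ℝ) < μ / 4 then (1 : ℝ) else 0) ≤
      4 / μ ^ 2 * ((triangles s).card - μ) ^ 2 + 4 / μ * sharingCount s := by
    intro s _
    have hs₀ : 0 ≤ sharingCount s := Finset.sum_nonneg fun x _ => by split_ifs <;> norm_num
    split_ifs with h
    · have hN := card_triangles_le_nu_add s
      by_cases hlt : ((triangles s).card : ℝ) ≤ μ / 2
      · have : 1 ≤ 4 / μ ^ 2 * ((triangles s).card - μ) ^ 2 := by
          rw [div_mul_eq_mul_div, one_le_div (by positivity)]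
          nlinarith
        have : 0 ≤ 4 / μ * sharingCount s := by positivity
        linarith
      · have : 1 ≤ 4 / μ * sharingCount s := by
          rw [div_mul_eq_mul_div, one_le_div (by positivity)]
          linarith
        have : 0 ≤ 4 / μ ^ 2 * ((triangles s).card - μ) ^ 2 := by positivity
        linarith
    · positivity
  refine (bernoulliExp_le hp₀ hp₁ hpt).trans ?_
  rw [bernoulliExp_add, bernoulliExp_const_mul, bernoulliExp_const_mul]
  calc _ ≤ 4 / μ ^ 2 * (μ + μ * κ) + 4 / μ * (μ * κ) := by
        gcongr
        exact hvar.trans (by linarith)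
    _ = _ := by field_simp

/-- If the expected codegree of a pair is at most `1 / 2`, then `ν` is rarely much smaller than the
expected number of triangles. -/
theorem bernoulliExp_nu_lt_le_of_thinning {p θ : ℝ} (hp₀ : 0 ≤ p) (hp₁ : p ≤ 1)
    (hV : 2 ≤ Fintype.card V) (hd : ((Fintype.card V : ℝ) - 2) * p ^ 2 ≤ 1 / 2)
    (hθ₀ : 0 < θ) (hθ₁ : θ ≤ 1) (hμ₀ : 0 < (Fintype.card V).choose 3 * p ^ 3) :
    bernoulliExp p (pairs V) (fun s => if (nu (graphOf s) : ℝ) <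
        θ ^ 3 * ((Fintype.card V).choose 3 * p ^ 3) / 4 then 1 else 0) ≤
      10 / (θ ^ 3 * ((Fintype.card V).choose 3 * p ^ 3)) + 6 * θ ^ 2 := by
  have hq₀ : 0 ≤ θ * p := by positivity
  have hqp : θ * p ≤ p := by nlinarith
  have hμ : θ ^ 3 * ((Fintype.card V).choose 3 * p ^ 3) =
      (Fintype.card V).choose 3 * (θ * p) ^ 3 := by ring
  have hμ₁ : 0 < (Fintype.card V).choose 3 * (θ * p) ^ 3 := by rw [← hμ]; positivity
  have hθ₂ : θ ^ 2 ≤ 1 := pow_le_one₀ hθ₀.le hθ₁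
  rw [hμ]
  -- At `θp` the expected codegree is at most `θ ^ 2 / 2`; the tail then transfers to `p` because
  -- `ν` is monotone.
  have h := bernoulliExp_nu_lt_le (V := V) (κ := 3 / 2 * θ ^ 2) hq₀ (hqp.trans hp₁) hV
    (by rw [mul_pow]; nlinarith [sq_nonneg θ]) hμ₁
  have hmono := bernoulliExp_mono hq₀ hqp hp₁ (D := pairs V)
    (f := fun s => - (if (nu (graphOf s) : ℝ) <
      (Fintype.card V).choose 3 * (θ * p) ^ 3 / 4 then 1 else 0)) fun s t hst _ => by
      have : (nu (graphOf s) : ℝ) ≤ nu (graphOf t) := mod_cast nu_mono hst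
      split_ifs <;> linarith
  simp only [neg_eq_neg_one_mul (ite _ _ _), bernoulliExp_const_mul] at hmono
  have : 4 * (1 + 3 / 2 * θ ^ 2) / ((Fintype.card V).choose 3 * (θ * p) ^ 3) ≤
      10 / ((Fintype.card V).choose 3 * (θ * p) ^ 3) := by
    gcongr
    linarith
  linarith

end Moments

/-! ### Combining the estimates -/

section Main

open Classical in
/-- The probability that `τ` and `ν` differ by more than `ε ν`, bounded for graphs with an expected
number of triangles below, and above, a given threshold. -/
theorem bernoulliExp_tau_sub_nu_gt_le {V : Type*} [Fintype V] [DecidableEq V] [Nonempty V]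
    {p δ θ ε : ℝ} (hp₀ : 0 ≤ p) (hp₁ : p ≤ 1)
    (hV : 2 ≤ Fintype.card V) (hd : ((Fintype.card V : ℝ) - 2) * p ^ 2 ≤ 1 / 2)
    (hδ₀ : 0 < δ) (hδ₁ : δ ≤ 1) (hθ₀ : 0 < θ) (hθ₁ : θ ≤ 1) (hε : 0 < ε) {M γ : ℝ} (hM : 0 < M)
    (hγ : 3 * δ + 12 * p / δ ^ 2 ≤ γ) :
    bernoulliExp p (pairs V) (fun s =>
        if ε * nu (graphOf s) < (tau (graphOf s) : ℝ) - nu (graphOf s) then 1 else 0) ≤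
      max (M * γ) (10 / (θ ^ 3 * M) + 6 * θ ^ 2 + 4 / (ε * θ ^ 3) * γ) := by
  have hmain := bernoulliExp_tau_sub_nu_le (V := V) hp₀ hp₁ hV hd hδ₀ hδ₁
  have htail := bernoulliExp_nu_lt_le_of_thinning (V := V) hp₀ hp₁ hV hd hθ₀ hθ₁
  set μ : ℝ := (Fintype.card V).choose 3 * p ^ 3 with hμ
  have hμ₀ : 0 ≤ μ := by positivity
  have hγ₀ : 0 ≤ γ := le_trans (by positivity) hγ
  have hmain' : bernoulliExp p (pairs V) (fun s => (tau (graphOf s) : ℝ) - nu (graphOf s)) ≤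
      μ * γ := hmain.trans (by gcongr)
  rcases le_or_gt μ M with h | h
  · refine le_trans ?_ (le_max_left _ _)
    refine le_trans (bernoulliExp_le hp₀ hp₁ fun s _ => ?_) (hmain'.trans (by gcongr))
    have hle : (nu (graphOf s) : ℝ) ≤ tau (graphOf s) := mod_cast nu_le_tau s
    split_ifs with hlt
    · have : (nu (graphOf s) : ℝ) < tau (graphOf s) := by
        have : 0 ≤ ε * nu (graphOf s) := by positivity
        linarith
      -- Integrality: a nonzero gap is at least one, so the expected gap bounds the probability.
      have : (nu (graphOf s) : ℝ) + 1 ≤ tau (graphOf s) := by exact_mod_cast this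
      linarith
    · linarith
  · refine le_trans ?_ (le_max_right _ _)
    have hμ₁ : 0 < μ := hM.trans h
    have hpt : ∀ s ⊆ pairs V,
        (if ε * nu (graphOf s) < (tau (graphOf s) : ℝ) - nu (graphOf s) then (1 : ℝ) else 0) ≤
        (if (nu (graphOf s) : ℝ) < θ ^ 3 * μ / 4 then 1 else 0) +
          4 / (ε * (θ ^ 3 * μ)) * ((tau (graphOf s) : ℝ) - nu (graphOf s)) := by
      intro s _
      have hle : 0 ≤ (tau (graphOf s) : ℝ) - nu (graphOf s) :=
        sub_nonneg.2 (mod_cast nu_le_tau s)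
      have h₀ : 0 ≤ 4 / (ε * (θ ^ 3 * μ)) * ((tau (graphOf s) : ℝ) - nu (graphOf s)) := by
        positivity
      by_cases h₁ : (nu (graphOf s) : ℝ) < θ ^ 3 * μ / 4
      · rw [if_pos h₁]
        split_ifs <;> linarith
      · rw [if_neg h₁, zero_add]
        split_ifs with h₂
        · rw [div_mul_eq_mul_div, one_le_div (by positivity)]
          have := mul_le_mul_of_nonneg_left (not_lt.1 h₁) hε.le
          linarith
        · exact h₀
    refine (bernoulliExp_le hp₀ hp₁ hpt).trans ?_
    rw [bernoulliExp_add, bernoulliExp_const_mul]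
    have h₁ : 10 / (θ ^ 3 * μ) ≤ 10 / (θ ^ 3 * M) := by gcongr
    have h₂ : 4 / (ε * (θ ^ 3 * μ)) *
        bernoulliExp p (pairs V) (fun s => (tau (graphOf s) : ℝ) - nu (graphOf s)) ≤
        4 / (ε * θ ^ 3) * γ := by
      calc _ ≤ 4 / (ε * (θ ^ 3 * μ)) * (μ * γ) := by gcongr
        _ = _ := by field_simp
    have := htail hμ₁
    linarith

/-- If `p ≥ c` with `n > 2 + 1 / c ^ 2`, the codegree would exceed `1`. -/
theorem eventually_lt_of_codegree_le {p : ℕ → unitInterval}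
    (hd : ∀ᶠ n : ℕ in atTop, ((n : ℝ) - 2) * (p n : ℝ) ^ 2 ≤ 1 / 2) {c : ℝ} (hc : 0 < c) :
    ∀ᶠ n : ℕ in atTop, (p n : ℝ) < c := by
  have hlarge : ∀ᶠ n : ℕ in atTop, 2 + 1 / c ^ 2 < (n : ℝ) :=
    tendsto_natCast_atTop_atTop.eventually_gt_atTop _
  filter_upwards [hd, hlarge] with n hn hn'
  by_contra! hlt
  have h₁ : 1 / c ^ 2 * c ^ 2 = 1 := by field_simp
  have h₂ : c ^ 2 ≤ (p n : ℝ) ^ 2 := by gcongr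
  have h₃ : 0 < 1 / c ^ 2 := by positivity
  nlinarith [mul_le_mul_of_nonneg_left h₂ h₃.le, sq_nonneg (p n : ℝ)]

end Main

end TriangleTuza

theorem mainTheorem2 (p : ℕ → unitInterval)
    (hd : ∀ᶠ n : ℕ in atTop, ((n : ℝ) - 2) * (p n : ℝ) ^ 2 ≤ 1 / 2) :
    ∀ ε : ℝ, 0 < ε →
      Tendsto
        (fun n : ℕ => SimpleGraph.binomialRandom (Fin n) (p n)
          {G : SimpleGraph (Fin n) |
            |(TriangleTuza.tau G : ℝ) - (TriangleTuza.nu G : ℝ)| ≤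
              ε * (TriangleTuza.nu G : ℝ)})
        atTop (𝓝 1) := by
  classical
  intro ε hε
  suffices h : Tendsto (fun n : ℕ => (SimpleGraph.binomialRandom (Fin n) (p n)).real
      {G : SimpleGraph (Fin n) | |(TriangleTuza.tau G : ℝ) - (TriangleTuza.nu G : ℝ)| ≤
        ε * (TriangleTuza.nu G : ℝ)}) atTop (𝓝 1) by
    have := ENNReal.tendsto_ofReal h
    rw [ENNReal.ofReal_one] at this
    exact this.congr fun n => MeasureTheory.ofReal_measureReal
  rw [Metric.tendsto_atTop']
  intro η hη
  -- The order of choice matters: `M` depends on `θ`, `γ` on both, `δ` on `γ`, and only then is `n`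
  -- taken large. The bounds leave `η / 2` for small `μ` and `3η / 4` for large `μ`.
  obtain ⟨θ, hθ₀, hθ₁, hθ⟩ : ∃ θ : ℝ, 0 < θ ∧ θ ≤ 1 ∧ 6 * θ ^ 2 ≤ η / 4 := by
    refine ⟨min 1 (η / 24), by positivity, min_le_left _ _, ?_⟩
    have h₀ : 0 < min 1 (η / 24) := by positivity
    have h₁ := min_le_left 1 (η / 24)
    have h₂ := min_le_right 1 (η / 24)
    nlinarith
  obtain ⟨M, hM₀, hM⟩ : ∃ M : ℝ, 0 < M ∧ 10 / (θ ^ 3 * M) ≤ η / 4 := by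
    refine ⟨40 / (θ ^ 3 * η), by positivity, le_of_eq ?_⟩
    field_simp
    norm_num
  obtain ⟨γ, hγ₀, hγ₁, hγ₂⟩ : ∃ γ : ℝ, 0 < γ ∧ M * γ ≤ η / 2 ∧
      4 / (ε * θ ^ 3) * γ ≤ η / 4 := by
    refine ⟨min (η / 2 / M) (η / 4 / (4 / (ε * θ ^ 3))), by positivity, ?_, ?_⟩
    · exact (le_div_iff₀' hM₀).1 (min_le_left _ _)
    · exact (le_div_iff₀' (by positivity)).1 (min_le_right _ _)
  obtain ⟨δ, hδ₀, hδ₁, hδ⟩ : ∃ δ : ℝ, 0 < δ ∧ δ ≤ 1 ∧ 3 * δ ≤ γ / 2 := by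
    refine ⟨min 1 (γ / 6), by positivity, min_le_left _ _, ?_⟩
    have := min_le_right 1 (γ / 6)
    linarith
  have hp := TriangleTuza.eventually_lt_of_codegree_le hd
    (show 0 < γ * δ ^ 2 / 24 by positivity)
  obtain ⟨N, hN⟩ := eventually_atTop.1 ((hd.and hp).and (eventually_ge_atTop 2))
  refine ⟨N, fun n hn => ?_⟩
  obtain ⟨⟨hdn, hpn⟩, hn2⟩ := hN n hn.le
  have : Nonempty (Fin n) := ⟨⟨0, by omega⟩⟩
  have hbad := TriangleTuza.bernoulliExp_tau_sub_nu_gt_le (V := Fin n) (p n).2.1 (p n).2.2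
    (by simpa using hn2) (by simpa using hdn) hδ₀ hδ₁ hθ₀ hθ₁ hε hM₀ (γ := γ) (by
      have : 12 * (p n : ℝ) / δ ^ 2 ≤ γ / 2 := by
        rw [div_le_iff₀ (by positivity)]
        linarith
      linarith)
  have hlt := hbad.trans_lt (show _ < η from max_lt (by linarith) (by linarith))
  have hcompl := TriangleTuza.bernoulliExp_add (p n : ℝ) (TriangleTuza.pairs (Fin n))
    (fun s => if ε * TriangleTuza.nu (TriangleTuza.graphOf s) <
      (TriangleTuza.tau (TriangleTuza.graphOf s) : ℝ) - TriangleTuza.nu (TriangleTuza.graphOf s)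
      then 1 else 0)
    (fun s => if SimpleGraph.fromEdgeSet (s : Set (Sym2 (Fin n))) ∈
      {G : SimpleGraph (Fin n) | |(TriangleTuza.tau G : ℝ) - (TriangleTuza.nu G : ℝ)| ≤
        ε * (TriangleTuza.nu G : ℝ)} then 1 else 0)
  -- Since `ν ≤ τ`, the absolute value is the plain difference and the two indicators are
  -- complementary.
  rw [← TriangleTuza.binomialRandom_real, TriangleTuza.bernoulliExp_congr _ (g := fun _ => 1),
    TriangleTuza.bernoulliExp_const] at hcompl
  · rw [Real.dist_eq, abs_sub_comm, abs_of_nonneg (sub_nonneg.2 MeasureTheory.measureReal_le_one)]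
    linarith
  · intro s _
    have hle : (0 : ℝ) ≤ (TriangleTuza.tau (TriangleTuza.graphOf s) : ℝ) -
        TriangleTuza.nu (TriangleTuza.graphOf s) :=
      sub_nonneg.2 (mod_cast TriangleTuza.nu_le_tau s)
    simp only [Set.mem_ofPred_eq, abs_of_nonneg hle]
    split_ifs <;> linarith
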